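/- **Infrastructure-Dominated Timeliness.** Packets of the classes $\mathcal K=\{M,SC,FC,S\}$ arrive at a gateway. For each activity factor $\rho\in(0,\rho_{\max}]$ the arrival stream is stationary: seen from a typical packet (packet $0$, arriving at time $a_0=0$), the sequence of interarrival times $\tau_n=a_{n+1}-a_n$, classes, service times and activation latencies, $n\in\mathbb Z$, is a stationary sequence. Class $k$ has arrival rate $\lambda_k(\rho)=\rho\lambda_s\pi_k$ with $\lambda_s>0$, $\pi_k\ge 0$, $\sum_k\pi_k=1$; put $\lambda(\rho)=\sum_k\lambda_k(\rho)$. A class-$k$ packet has a random service time $S_k\in[0,C_k]$. The receiver has a readiness state $R(t)\in\{0,1\}$ with long-term average $\delta\in(0,1]$ not depending on $\rho$; a packet first waits for its activation latency $V$, the time until the receiver is ready, and $V\le V_{\max}(1-\delta)$ with $V_{\max}\ge0$; the receiver then stays ready as long as released packets are unfinished. Released packets are served by a single server with preemptive-resume fixed priorities $S\succ FC\succ SC\succ M$, first come first served inside a class. Let $W_k(\rho)$ be the time that a typical class-$k$ packet, after its activation latency, is not being served, and $T_k(\rho)=V+W_k(\rho)+S_k$ its response time. Let $\mathcal K_M\subseteq\mathcal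 K$ be the nonempty set of monitoring classes, with $\pi_k>0$ for $k\in\mathcal K_M$, and let $\mu>0$, $\Delta_{\mathrm{tar}}>0$, $\mathrm{SFRT}^*>0$, $D_k>0$, $\Gamma_k\in(0,1]$, $w_1,w_2,w_3\ge0$. Define $$\mathbb E[\mathrm{AoS}(\rho)]=\max_{k\in\mathcal K_M}\Big(\frac1{\lambda_k(\rho)}+\frac{\mathbb E[W_k(\rho)]}{2}+\frac1{\mu\delta}\Big),\qquad F(\rho)=\min\Big(1,\frac{\Delta_{\mathrm{tar}}}{\mathbb E[\mathrm{AoS}(\rho)]}\Big),$$ $$R(\rho)=\min_{k\in\mathcal K}\big(1-\Pr\{T_k(\rho)>D_k\}\big)\Gamma_k,\qquad S(\rho)=\exp\Big(-\frac{\max_{k}B_k(\delta)}{\mathrm{SFRT}^*}\Big),$$ $$B_k(\delta)=V_{\max}(1-\delta)+\sum_{i\in\mathrm{hp}(k)}C_i+C_k,\qquad \Psi(\rho)=F(\rho)^{w_1}R(\rho)^{w_2}S(\rho)^{w_3},$$ where $\mathrm{hp}(k)$ is the set of classes of higher priority than $k$ (for a class without traffic the miss probability is $0$), and $$F_0(\rho)=\min\Big(1,\frac{\Delta_{\mathrm{tar}}}{\max_{k\in\mathcal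 K_M}\big(\frac1{\rho\lambda_s\pi_k}+\frac1{\mu\delta}\big)}\Big),\qquad \Gamma_{\min}=\min_{k\in\mathcal K}\Gamma_k .$$ Suppose that the utilization $\lambda(\rho)/(\mu\delta)$ tends to $0$ as $\rho\to0^+$, that there is deterministic slack $D_k>V_{\max}(1-\delta)+C_k$ for all $k\in\mathcal K$, and that arrivals do not cluster in the sparse limit: (i) $\Pr\{\tau_0\le h\}\to0$ as $\rho\to0^+$ for every fixed $h$; (ii) there are constants $K$ and $q<1$ with $\mathbb E\,e^{-\lambda(\rho)(\tau_0+\dots+\tau_{n-1})}\le Kq^n$ for all $n\ge0$ and $\rho\in(0,\rho_{\max}]$. (Both hold for independent Poisson arrivals.) Then, as $\rho\to0^+$, $$\Psi(\rho)\sim F_0(\rho)^{w_1}\,\Gamma_{\min}^{w_2}\exp\Big(-w_3\frac{\max_kB_k(\delta)}{\mathrm{SFRT}^*}\Big),$$ where $f\sim g$ means that $f(\rho)/g(\rho)\to1$, and the difference of the two sides tends to $0$; moreover $F(\rho)\sim F_0(\rho)$, $R(\rho)\to\Gamma_{\min}$, and $S(\rho)$ does not depend on $\rho$. -/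

import Mathlib

open Filter Topology MeasureTheory ProbabilityTheory Asymptotics
open scoped ENNReal

noncomputable section

namespace USAM

/-- The four traffic classes: monitoring, slow control, fast control, safety. -/
inductive TrafficClass
  | M
  | SC
  | FC
  | S
  deriving DecidableEq

instance : Fintype TrafficClass := ⟨{.M, .SC, .FC, .S}, fun k => by cases k <;> decide⟩

instance : MeasurableSpace TrafficClass := ⊤

instance : Nonempty TrafficClass := ⟨TrafficClass.M⟩

/-- Fixed priorities `S ≻ FC ≻ SC ≻ M`. -/
def TrafficClass.priority : TrafficClass → ℕ
  | .M => 0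
  | .SC => 1
  | .FC => 2
  | .S => 3

/-- The classes of higher priority than `k`. -/
def TrafficClass.hp (k : TrafficClass) : Finset TrafficClass :=
  Finset.univ.filter fun i => k.priority < i.priority

/-- The constants of the system; none of them depends on the activity factor. -/
structure Params where
  /-- nominal service rate -/
  μ : ℝ
  /-- receiver duty cycle -/
  δ : ℝ
  /-- maximal activation latency -/
  Vmax : ℝ
  /-- maximal service requirement of each class -/
  C : TrafficClass → ℝ
  /-- arrival-rate scale -/
  lamS : ℝ
  /-- traffic mix -/
  mix : TrafficClass → ℝ
  /-- monitoring classes -/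
  KM : Finset TrafficClass
  /-- target synchronization level -/
  Δtar : ℝ
  /-- deadlines -/
  D : TrafficClass → ℝ
  /-- residual safety factors -/
  Γ : TrafficClass → ℝ
  /-- reference safety functional response time -/
  SFRT : ℝ
  w₁ : ℝ
  w₂ : ℝ
  w₃ : ℝ
  μ_pos : 0 < μ
  δ_pos : 0 < δ
  δ_le_one : δ ≤ 1
  Vmax_nonneg : 0 ≤ Vmax
  C_nonneg : ∀ k, 0 ≤ C k
  lamS_pos : 0 < lamS
  mix_nonneg : ∀ k, 0 ≤ mix k
  mix_sum : ∑ k, mix k = 1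
  KM_nonempty : KM.Nonempty
  mix_pos : ∀ k ∈ KM, 0 < mix k
  Δtar_pos : 0 < Δtar
  D_pos : ∀ k, 0 < D k
  Γ_pos : ∀ k, 0 < Γ k
  Γ_le_one : ∀ k, Γ k ≤ 1
  SFRT_pos : 0 < SFRT
  w₁_nonneg : 0 ≤ w₁
  w₂_nonneg : 0 ≤ w₂
  w₃_nonneg : 0 ≤ w₃

/-- The random input of the gateway queue at one value of the activity factor, as seen from a
typical packet: packets are indexed by `ℤ` in the order of their arrival, and packet `0` is the
typical packet, which arrives at time `0`. -/
structure Queue (Ω : Type*) where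
  /-- arrival time of packet `n` -/
  arrival : ℤ → Ω → ℝ
  /-- traffic class of packet `n` -/
  cls : ℤ → Ω → TrafficClass
  /-- service time of packet `n` -/
  service : ℤ → Ω → ℝ
  /-- readiness state `R(t) ∈ {0, 1}` of the receiver -/
  ready : ℝ → Ω → ℝ

namespace Queue

variable {Ω : Type*} (Q : Queue Ω)

/-- Time between the arrivals of packets `n` and `n + 1`. -/
def gap (n : ℤ) (ω : Ω) : ℝ := Q.arrival (n + 1) ω - Q.arrival n ω

/-- Activation latency of packet `n`: the time from its arrival until the receiver is ready
(`0` if the receiver is ready at the arrival). -/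
def activation (n : ℤ) (ω : Ω) : ℝ :=
  sInf {s : ℝ | 0 ≤ s ∧ Q.ready (Q.arrival n ω + s) ω = 1}

/-- The time at which packet `n` becomes available for service. -/
def release (n : ℤ) (ω : Ω) : ℝ := Q.arrival n ω + Q.activation n ω

/-- Packet `i` is served before the completion of packet `m` if both are present: it has higher
priority, or it belongs to the same class and has not arrived later (this includes `i = m`). -/
def Ahead (i m : ℤ) (ω : Ω) : Prop :=
  (Q.cls m ω).priority < (Q.cls i ω).priority ∨ (Q.cls i ω = Q.cls m ω ∧ i ≤ m)

open Classical in
/-- Total service time of the packets ahead of `m` (and `m` itself) that are released not before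
packet `j`, and either not after packet `m` or less than `x` time units after packet `m`. -/
def load (j m : ℤ) (x : ℝ≥0∞) (ω : Ω) : ℝ≥0∞ :=
  ∑' i : ℤ,
    if Q.Ahead i m ω ∧ Q.release j ω ≤ Q.release i ω ∧
        (Q.release i ω ≤ Q.release m ω ∨
          ENNReal.ofReal (Q.release i ω - Q.release m ω) < x)
    then ENNReal.ofReal (Q.service i ω) else 0

/-- Time from the release of packet `m` to its completion in the single-server queue with
preemptive-resume fixed-priority service (first come, first served inside a class). Lower-priority
packets do not matter, so packet `m` is completed at the first moment `x` after its release at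
which the server has had time for all the work ahead of it: for every starting point `release j`,
the work released since then does not exceed the time elapsed since then. The value is `∞` if the
packet is never completed. -/
def sojourn (m : ℤ) (ω : Ω) : ℝ≥0∞ :=
  sInf {x : ℝ≥0∞ | ∀ j : ℤ, Q.release j ω ≤ Q.release m ω →
    Q.load j m x ω ≤ x + ENNReal.ofReal (Q.release m ω - Q.release j ω)}

/-- Queueing delay of packet `m`: the time after its activation latency during which it is not
served. -/
def wait (m : ℤ) (ω : Ω) : ℝ≥0∞ := Q.sojourn m ω - ENNReal.ofReal (Q.service m ω)

/-- Response time: activation latency, queueing delay and service time. -/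
def response (m : ℤ) (ω : Ω) : ℝ≥0∞ :=
  ENNReal.ofReal (Q.activation m ω) + Q.wait m ω + ENNReal.ofReal (Q.service m ω)

variable [MeasurableSpace Ω] (P : Measure Ω)

/-- Arrival rate of class `k`: the fraction of class-`k` packets over the mean interarrival time. -/
def rate (k : TrafficClass) : ℝ := P.real {ω | Q.cls 0 ω = k} / ∫ ω, Q.gap 0 ω ∂P

/-- Aggregate arrival rate. -/
def totalRate : ℝ := ∑ k, Q.rate P k

/-- System utilization. -/
def utilization (p : Params) : ℝ := Q.totalRate P / (p.μ * p.δ)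

/-- Mean queueing delay of a typical class-`k` packet. -/
def meanWait (k : TrafficClass) : ℝ≥0∞ := ∫⁻ ω, Q.wait 0 ω ∂(P[|{ω | Q.cls 0 ω = k}])

/-- Probability that a typical class-`k` packet misses its deadline. -/
def missProb (p : Params) (k : TrafficClass) : ℝ :=
  (P[|{ω | Q.cls 0 ω = k}]).real {ω | ENNReal.ofReal (p.D k) < Q.response 0 ω}

/-- The queue at activity factor `ρ`. -/
structure IsModel (p : Params) (ρ : ℝ) : Prop where
  measurable_arrival : ∀ n, Measurable (Q.arrival n)
  measurable_cls : ∀ n, Measurable (Q.cls n)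
  measurable_service : ∀ n, Measurable (Q.service n)
  measurable_activation : ∀ n, Measurable (Q.activation n)
  arrival_zero : ∀ᵐ ω ∂P, Q.arrival 0 ω = 0
  arrival_mono : ∀ᵐ ω ∂P, Monotone fun n => Q.arrival n ω
  /-- Bounded service times. -/
  service_mem : ∀ᵐ ω ∂P, ∀ n, Q.service n ω ∈ Set.Icc 0 (p.C (Q.cls n ω))
  ready_zero_or_one : ∀ᵐ ω ∂P, ∀ t, Q.ready t ω = 0 ∨ Q.ready t ω = 1
  measurable_ready : ∀ᵐ ω ∂P, Measurable fun t => Q.ready t ω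
  /-- The receiver has long-term duty cycle `δ`. -/
  duty_cycle : ∀ᵐ ω ∂P,
    Tendsto (fun T : ℝ => 1 / T * ∫ t in (0 : ℝ)..T, Q.ready t ω) atTop (𝓝 p.δ)
  /-- Every packet finds the receiver ready within `Vmax (1 - δ)` time units. -/
  activation_bound : ∀ᵐ ω ∂P, ∀ n, ∃ s ∈ Set.Icc 0 (p.Vmax * (1 - p.δ)),
    Q.ready (Q.arrival n ω + s) ω = 1
  /-- The receiver is ready whenever a released packet is not yet completed: packets are served
  only by a ready receiver, and activation precedes service but does not interrupt it. -/
  ready_of_busy : ∀ᵐ ω ∂P, ∀ n t, Q.release n ω ≤ t →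
    ENNReal.ofReal (t - Q.release n ω) < Q.sojourn n ω → Q.ready t ω = 1
  /-- Stationarity: every packet sees what packet `0` sees. -/
  stationary :
    P.map (fun ω (n : ℤ) =>
      (Q.gap (n + 1) ω, Q.cls (n + 1) ω, Q.service (n + 1) ω, Q.activation (n + 1) ω)) =
    P.map (fun ω (n : ℤ) => (Q.gap n ω, Q.cls n ω, Q.service n ω, Q.activation n ω))
  integrable_gap : Integrable (Q.gap 0) P
  /-- Class `k` has arrival rate `ρ λ_s π_k`. -/
  rate_eq : ∀ k, Q.rate P k = ρ * p.lamS * p.mix k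

/-- Mean Age of Synchronization. -/
def meanAoS (p : Params) : ℝ≥0∞ :=
  p.KM.sup' p.KM_nonempty fun k =>
    (ENNReal.ofReal (Q.rate P k))⁻¹ + Q.meanWait P k / 2 + (ENNReal.ofReal (p.μ * p.δ))⁻¹

/-- Freshness factor `F`. -/
def freshness (p : Params) : ℝ := (min 1 (ENNReal.ofReal p.Δtar / Q.meanAoS P p)).toReal

/-- Safe packet delivery probability. -/
def SPDP (p : Params) (k : TrafficClass) : ℝ := (1 - Q.missProb P p k) * p.Γ k

/-- Reliability component `R`. -/
def reliability (p : Params) : ℝ :=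
  Finset.univ.inf' Finset.univ_nonempty fun k => Q.SPDP P p k

end Queue

namespace Params

variable (p : Params)

/-- Worst-case response-time bound `B_k(δ)`. -/
def B (k : TrafficClass) : ℝ := p.Vmax * (1 - p.δ) + ∑ i ∈ k.hp, p.C i + p.C k

/-- `max_k B_k(δ)` -/
def Bmax : ℝ := Finset.univ.sup' Finset.univ_nonempty p.B

/-- `min_k Γ_k` -/
def Γmin : ℝ := Finset.univ.inf' Finset.univ_nonempty p.Γ

/-- The freshness factor without queueing delay, at activity factor `ρ`. -/
def F₀ (ρ : ℝ) : ℝ :=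
  min 1 (p.Δtar / p.KM.sup' p.KM_nonempty fun k =>
    1 / (ρ * p.lamS * p.mix k) + 1 / (p.μ * p.δ))

end Params

/-- Safety component `S(ρ)`. -/
def safety (p : Params) (_ρ : ℝ) : ℝ := Real.exp (-(p.Bmax / p.SFRT))

/-- The Unified Safety–Age Metric at activity factor `ρ`, for a family of queues indexed by the
activity factor. -/
def usam {Ω : Type*} [MeasurableSpace Ω] (P : Measure Ω) (p : Params) (Q : ℝ → Queue Ω)
    (ρ : ℝ) : ℝ :=
  (Q ρ).freshness P p ^ p.w₁ * (Q ρ).reliability P p ^ p.w₂ * safety p ρ ^ p.w₃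

end USAM

end

/-! Write `A n` for the arrival time of packet `n`, `C` and `V` for bounds of all service times and
latencies. On a sample path, the work found by packet `0` is controlled by comparing the distances
`-A (-n)` with the linear function `n * C + V`: if every past packet is at least that far away and
the next arrival comes later than `V + C`, packet `0` does not wait at all. In general its delay is
at most a constant plus sums of the positive parts of `n * 2C + V + A (-n)` and `n * 2C + V - A n`.

By stationarity `-A (-n)` and `A n` have the same law, and the Chernoff bound with exponent `λ(ρ)`
gives `P (A n ≤ n * c + v) ≤ exp (λ(ρ) * (n * c + v)) * K * q ^ n`. Since `λ(ρ) → 0`, this is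
geometric in `n`, uniformly for small `ρ` (`exists_geometric_bound`). Two consequences carry the
theorem. By dominated convergence the sum of these probabilities vanishes, so a packet waits with
vanishing probability, the slack excludes a miss, and `R → Γmin` (`tendsto_reliability`). The sum
with linear weights stays finite, so mean delays are bounded (`exists_meanWait_le`); the age without
delay tends to infinity, so a bounded correction does not change `F` asymptotically
(`tendsto_freshness_div`). As `F₀ → 0`, freshness has to be compared through a ratio and not through
limits. -/

namespace USAM

/-! ### Work and delay on a single sample path. -/

/-- The multiples of `C` that do not exceed `t` are at most `t / C` in number. -/
theorem tsum_ite_mul_le {C t : ℝ} (hC : 0 < C) :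
    ∑' n : ℕ, (if ((n : ℝ) + 1) * C ≤ t then ENNReal.ofReal C else 0) ≤ ENNReal.ofReal t := by
  rcases lt_or_ge t 0 with ht | ht
  · have h0 : ∀ n : ℕ, (if ((n : ℝ) + 1) * C ≤ t then ENNReal.ofReal C else 0) = 0 := by
      intro n
      have : 0 ≤ ((n : ℝ) + 1) * C := by positivity
      rw [if_neg (by linarith)]
    simp [h0]
  · rw [tsum_eq_sum (s := Finset.range ⌊t / C⌋₊)]
    · calc ∑ n ∈ Finset.range ⌊t / C⌋₊, (if ((n : ℝ) + 1) * C ≤ t then ENNReal.ofReal C else 0)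
          ≤ ∑ n ∈ Finset.range ⌊t / C⌋₊, ENNReal.ofReal C :=
            Finset.sum_le_sum fun n _ => by split_ifs <;> simp
        _ = ENNReal.ofReal (⌊t / C⌋₊ * C) := by
            rw [Finset.sum_const, Finset.card_range, nsmul_eq_mul,
              ENNReal.ofReal_mul (by positivity), ENNReal.ofReal_natCast]
        _ ≤ ENNReal.ofReal t := by
            apply ENNReal.ofReal_le_ofReal
            have := Nat.floor_le (div_nonneg ht hC.le)
            rwa [le_div_iff₀ hC] at this
    · intro n hn
      rw [if_neg]
      intro h
      apply hn
      rw [Finset.mem_range, Nat.lt_iff_add_one_le, Nat.le_floor_iff (div_nonneg ht hC.le),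
        le_div_iff₀ hC]
      push_cast
      exact h

theorem tsum_int_eq_add_tsum_nat (g : ℤ → ℝ≥0∞) :
    ∑' i, g i = g 0 + ∑' n : ℕ, g (n + 1) + ∑' n : ℕ, g (-(n + 1)) := by
  rw [tsum_of_nat_of_neg_add_one ENNReal.summable ENNReal.summable,
    tsum_eq_zero_add' ENNReal.summable]
  simp

namespace Queue

variable {Ω : Type*} (Q : Queue Ω)

/-- The sample-path properties of the input: packet `0` arrives at time `0`, arrivals are ordered,
service times are bounded by `C` and activation latencies by `V`. -/
structure BoundedPath (C V : ℝ) (ω : Ω) : Prop where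
  arrival_zero : Q.arrival 0 ω = 0
  arrival_mono : Monotone fun n => Q.arrival n ω
  service_nonneg : ∀ n, 0 ≤ Q.service n ω
  service_le : ∀ n, Q.service n ω ≤ C
  activation_nonneg : ∀ n, 0 ≤ Q.activation n ω
  activation_le : ∀ n, Q.activation n ω ≤ V

variable {Q} {C V : ℝ} {ω : Ω}

/-- If the past work is served up to a backlog `y` and the future work interfering within `x` is at
most `f`, then packet `0` is completed by the time `x` after its release. -/
theorem BoundedPath.sojourn_le (h : Q.BoundedPath C V ω) (hC : 0 < C) {x y f : ℝ}
    (hy : 0 ≤ y) (hf : 0 ≤ f)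
    (past : ∀ n : ℕ, ((n : ℝ) + 1) * C + V + Q.arrival (-(n + 1)) ω ≤ y)
    (future : ∀ n : ℕ, Q.arrival (n + 1) ω ≤ V + x → ((n : ℝ) + 1) * C ≤ f)
    (hx : Q.service 0 ω + y + f ≤ x) :
    Q.sojourn 0 ω ≤ ENNReal.ofReal x := by
  classical
  have hS := h.service_nonneg 0
  have hx0 : 0 ≤ x := by linarith
  refine sInf_le ?_
  intro j hj
  have hd : 0 ≤ Q.release 0 ω - Q.release j ω := sub_nonneg.2 hj
  have hrel0 : Q.release 0 ω = Q.activation 0 ω := by simp [release, h.arrival_zero]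
  rw [load, tsum_int_eq_add_tsum_nat]
  have h0 : ∀ p : Prop, ∀ [Decidable p],
      (if p then ENNReal.ofReal (Q.service 0 ω) else 0) ≤ ENNReal.ofReal (Q.service 0 ω) := by
    intro p _
    split_ifs <;> simp
  -- A past packet `-(n + 1)` counted in the load is released no earlier than `j`, which with `past`
  -- forces `(n + 1) * C` below this `t`. The past work is thus at most `y` plus the time elapsed
  -- since `release j`, and the elapsed time is granted on the right-hand side.
  have hpast := tsum_ite_mul_le (t := y + (Q.release 0 ω - Q.release j ω)) hC
  have hfut := tsum_ite_mul_le (t := f) hC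
  calc _ ≤ ENNReal.ofReal (Q.service 0 ω) + ENNReal.ofReal f
        + ENNReal.ofReal (y + (Q.release 0 ω - Q.release j ω)) := by
        refine add_le_add (add_le_add (h0 _) (le_trans (ENNReal.tsum_le_tsum fun n => ?_) hfut))
          (le_trans (ENNReal.tsum_le_tsum fun n => ?_) hpast)
        · split_ifs with h1 h2
          · exact ENNReal.ofReal_le_ofReal (h.service_le _)
          · exfalso
            apply h2
            apply future
            have ha := h.activation_nonneg ((n : ℤ) + 1)
            have hV := h.activation_le 0
            have hr : Q.release ((n : ℤ) + 1) ω
              = Q.arrival ((n : ℤ) + 1) ω + Q.activation ((n : ℤ) + 1) ω := rfl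
            rcases h1.2.2 with h3 | h3
            · linarith
            · have := (ENNReal.ofReal_lt_ofReal_iff').1 h3
              linarith [this.1]
          · exact zero_le
          · exact le_rfl
        · split_ifs with h1 h2
          · exact ENNReal.ofReal_le_ofReal (h.service_le _)
          · exfalso
            apply h2
            have ha := h.activation_le (-((n : ℤ) + 1))
            have hV := h.activation_nonneg 0
            have hr : Q.release (-((n : ℤ) + 1)) ω
              = Q.arrival (-((n : ℤ) + 1)) ω + Q.activation (-((n : ℤ) + 1)) ω := rfl
            have := h1.2.1
            have := past n
            linarith
          · exact zero_le
          · exact le_rfl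
    _ = ENNReal.ofReal (Q.service 0 ω + f + (y + (Q.release 0 ω - Q.release j ω))) := by
        rw [← ENNReal.ofReal_add hS hf, ← ENNReal.ofReal_add (by positivity) (by positivity)]
    _ ≤ ENNReal.ofReal (x + (Q.release 0 ω - Q.release j ω)) :=
        ENNReal.ofReal_le_ofReal (by linarith)
    _ = _ := ENNReal.ofReal_add hx0 hd

/-- A packet without backlog before it and with enough time to the next arrival does not wait. -/
theorem BoundedPath.wait_eq_zero (h : Q.BoundedPath C V ω) (hC : 0 < C)
    (past : ∀ n : ℕ, ((n : ℝ) + 1) * C + V ≤ -Q.arrival (-(n + 1)) ω)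
    (next : V + C < Q.arrival 1 ω) : Q.wait 0 ω = 0 := by
  -- Here `x` is the service time of packet `0`; the future condition is vacuous because no packet
  -- arrives by `V + x`.
  refine tsub_eq_zero_of_le (h.sojourn_le hC (y := 0) (f := 0) le_rfl le_rfl (fun n => ?_)
    (fun n hn => ?_) (by simp))
  · linarith [past n]
  · have h1 : Q.arrival 1 ω ≤ Q.arrival ((n : ℤ) + 1) ω := h.arrival_mono (by omega)
    linarith [h.service_le 0]

/-- Bound of the queueing delay by the total excess of the work over the interarrival times. -/
theorem BoundedPath.wait_le (h : Q.BoundedPath C V ω) (hC : 0 < C) :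
    Q.wait 0 ω ≤ ENNReal.ofReal (2 * C + V) +
      2 * ∑' n : ℕ, ENNReal.ofReal (((n : ℝ) + 1) * (2 * C) + V + Q.arrival (-(n + 1)) ω) +
      ∑' n : ℕ, ENNReal.ofReal (((n : ℝ) + 1) * (2 * C) + V - Q.arrival (n + 1) ω) := by
  have hV : 0 ≤ V := (h.activation_nonneg 0).trans (h.activation_le 0)
  set Y := ∑' n : ℕ, ENNReal.ofReal (((n : ℝ) + 1) * (2 * C) + V + Q.arrival (-(n + 1)) ω)
    with hY
  set Z := ∑' n : ℕ, ENNReal.ofReal (((n : ℝ) + 1) * (2 * C) + V - Q.arrival (n + 1) ω) with hZ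
  rcases eq_or_ne Y ∞ with hYt | hYt
  · simp [hYt]
  rcases eq_or_ne Z ∞ with hZt | hZt
  · simp [hZt]
  have hs0 := h.service_nonneg 0
  have hy : 0 ≤ Y.toReal := ENNReal.toReal_nonneg
  have hz : 0 ≤ Z.toReal := ENNReal.toReal_nonneg
  -- Charging `2 * C` per packet when each costs at most `C` makes the fixed point solvable:
  -- arrivals up to `V + x` bring work at most `(x + Z) / 2`. With `x = service + Y + f` this is at
  -- most `f` as soon as `f ≥ service + Y + Z`.
  have key := h.sojourn_le hC (x := 2 * Q.service 0 ω + 2 * Y.toReal + Z.toReal + V)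
    (y := Y.toReal) (f := Q.service 0 ω + Y.toReal + Z.toReal + V) hy (by positivity)
    (fun n => ?_) (fun n hn => ?_) (by linarith)
  · calc Q.wait 0 ω ≤ Q.sojourn 0 ω := tsub_le_self
      _ ≤ ENNReal.ofReal (2 * C + V + 2 * Y.toReal + Z.toReal) :=
        key.trans (ENNReal.ofReal_le_ofReal (by linarith [h.service_le 0]))
      _ = _ := by
        rw [ENNReal.ofReal_add (by positivity) hz, ENNReal.ofReal_add (by positivity)
          (by positivity), ENNReal.ofReal_mul (by norm_num), ENNReal.ofReal_toReal hYt,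
          ENNReal.ofReal_toReal hZt]
        norm_num
  · have h1 := (ENNReal.ofReal_le_iff_le_toReal hYt).1 (ENNReal.le_tsum n : _ ≤ Y)
    have : 0 ≤ ((n : ℝ) + 1) * C := by positivity
    linarith
  · have h1 := (ENNReal.ofReal_le_iff_le_toReal hZt).1 (ENNReal.le_tsum n : _ ≤ Z)
    linarith

end Queue

/-! ### Stationarity, tail bounds and the delay of a typical packet. -/

/-- A positive bound of all service times. -/
noncomputable def Params.serviceBound (p : Params) : ℝ := ∑ k, p.C k + 1

/-- A bound of all activation latencies. -/
noncomputable def Params.latencyBound (p : Params) : ℝ := p.Vmax * (1 - p.δ)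

theorem Params.serviceBound_pos (p : Params) : 0 < p.serviceBound := by
  have : 0 ≤ ∑ k, p.C k := Finset.sum_nonneg fun k _ => p.C_nonneg k
  unfold serviceBound
  linarith

theorem Params.le_serviceBound (p : Params) (k : TrafficClass) : p.C k ≤ p.serviceBound := by
  have : p.C k ≤ ∑ k, p.C k :=
    Finset.single_le_sum (fun k _ => p.C_nonneg k) (Finset.mem_univ k)
  unfold serviceBound
  linarith

theorem Params.latencyBound_nonneg (p : Params) : 0 ≤ p.latencyBound :=
  mul_nonneg p.Vmax_nonneg (sub_nonneg.2 p.δ_le_one)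

/-- The positive part of `t - X` is at most `t` on `{X ≤ t}` and zero elsewhere. -/
theorem lintegral_ofReal_sub_le {Ω : Type*} [MeasurableSpace Ω] {P : Measure Ω}
    {X : Ω → ℝ} (hX : Measurable X) (h0 : ∀ᵐ ω ∂P, 0 ≤ X ω) (t : ℝ) :
    ∫⁻ ω, ENNReal.ofReal (t - X ω) ∂P ≤ ENNReal.ofReal t * P {ω | X ω ≤ t} := by
  rw [← lintegral_indicator_const (measurableSet_le hX measurable_const)]
  refine lintegral_mono_ae ?_
  filter_upwards [h0] with ω h
  by_cases hω : X ω ≤ t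
  · rw [Set.indicator_of_mem (by exact hω)]
    exact ENNReal.ofReal_le_ofReal (by linarith)
  · rw [ENNReal.ofReal_of_nonpos (by linarith)]
    exact zero_le

namespace Queue

theorem arrival_natCast_eq_sum_gap {Ω : Type*} {Q : Queue Ω} {ω : Ω} (h : Q.arrival 0 ω = 0)
    (n : ℕ) : Q.arrival n ω = ∑ i ∈ Finset.range n, Q.gap i ω := by
  have := Finset.sum_range_sub (fun i : ℕ => Q.arrival (i : ℤ) ω) n
  simp only [Nat.cast_add, Nat.cast_one, Nat.cast_zero, h, sub_zero] at this
  exact this.symm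

theorem neg_arrival_neg_natCast_eq_sum_gap {Ω : Type*} {Q : Queue Ω} {ω : Ω}
    (h : Q.arrival 0 ω = 0) (n : ℕ) :
    -Q.arrival (-n) ω = ∑ i ∈ Finset.range n, Q.gap (i - n) ω := by
  have := Finset.sum_range_sub (fun i : ℕ => Q.arrival ((i : ℤ) - n) ω) n
  simp only [Nat.cast_add, Nat.cast_one, Nat.cast_zero, sub_self, h, zero_sub] at this
  rw [← this]
  refine Finset.sum_congr rfl fun i _ => ?_
  rw [gap, sub_add_eq_add_sub]

namespace IsModel

variable {Ω : Type*} [MeasurableSpace Ω] {P : Measure Ω} {Q : Queue Ω} {p : Params} {ρ : ℝ}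

theorem boundedPath (hQ : Q.IsModel P p ρ) :
    ∀ᵐ ω ∂P, Q.BoundedPath p.serviceBound p.latencyBound ω := by
  filter_upwards [hQ.arrival_zero, hQ.arrival_mono, hQ.service_mem, hQ.activation_bound]
    with ω h0 hm hs ha
  refine ⟨h0, hm, fun n => (hs n).1, fun n => (hs n).2.trans (p.le_serviceBound _),
    fun n => Real.sInf_nonneg fun s hs => hs.1, fun n => ?_⟩
  obtain ⟨s, hs, hr⟩ := ha n
  have hmem : s ∈ {s : ℝ | 0 ≤ s ∧ Q.ready (Q.arrival n ω + s) ω = 1} := ⟨hs.1, hr⟩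
  have hbdd : BddBelow {s : ℝ | 0 ≤ s ∧ Q.ready (Q.arrival n ω + s) ω = 1} :=
    ⟨0, fun s hs => hs.1⟩
  exact (csInf_le hbdd hmem).trans hs.2

theorem measurable_gap (hQ : Q.IsModel P p ρ) (n : ℤ) : Measurable (Q.gap n) :=
  (hQ.measurable_arrival _).sub (hQ.measurable_arrival _)

theorem measurableSet_cls (hQ : Q.IsModel P p ρ) (k : TrafficClass) :
    MeasurableSet {ω | Q.cls 0 ω = k} :=
  hQ.measurable_cls 0 (show MeasurableSet {k} by trivial)

/-- Iterating the one-step shift carries the `m` gaps before packet `0` onto the `m` gaps after it.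
-/
theorem map_gap_sub (hQ : Q.IsModel P p ρ) (m : ℕ) :
    P.map (fun ω (i : ℤ) => Q.gap (i - m) ω) = P.map (fun ω (i : ℤ) => Q.gap i ω) := by
  have hg := hQ.measurable_gap
  have hmeas : ∀ s : ℤ, Measurable (fun ω (n : ℤ) =>
      (Q.gap (n + s) ω, Q.cls (n + s) ω, Q.service (n + s) ω, Q.activation (n + s) ω)) :=
    fun s => measurable_pi_lambda _ fun n => (hg _).prodMk ((hQ.measurable_cls _).prodMk
      ((hQ.measurable_service _).prodMk (hQ.measurable_activation _)))
  induction m with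
  | zero => simp
  | succ m ih =>
    rw [← ih]
    have hφ : Measurable (fun (x : ℤ → ℝ × TrafficClass × ℝ × ℝ) (i : ℤ) =>
        (x (i - (m + 1 : ℕ))).1) := by fun_prop
    -- Read at `i - (m + 1)`, the shifted sequence shows gap `i - m` and the unshifted one gap `i -
    -- (m + 1)`.
    have := congrArg (fun ν => ν.map (fun (x : ℤ → ℝ × TrafficClass × ℝ × ℝ) (i : ℤ) =>
        (x (i - (m + 1 : ℕ))).1)) hQ.stationary
    rw [Measure.map_map hφ (hmeas 1), Measure.map_map hφ (by simpa using hmeas 0)] at this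
    rw [show (fun ω (i : ℤ) => Q.gap (i - m) ω) = (fun (x : ℤ → ℝ × TrafficClass × ℝ × ℝ)
      (i : ℤ) => (x (i - (m + 1 : ℕ))).1) ∘ (fun ω (n : ℤ) =>
      (Q.gap (n + 1) ω, Q.cls (n + 1) ω, Q.service (n + 1) ω, Q.activation (n + 1) ω)) from ?_]
    · rw [this]
      rfl
    · funext ω i
      simp only [Function.comp_apply]
      congr 1
      push_cast
      ring

/-- Seen from a typical packet, past and future arrivals have the same distances in law. -/
theorem identDistrib_arrival (hQ : Q.IsModel P p ρ) (n : ℕ) :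
    IdentDistrib (fun ω => -Q.arrival (-n) ω) (Q.arrival n) P P where
  aemeasurable_fst := (hQ.measurable_arrival _).neg.aemeasurable
  aemeasurable_snd := (hQ.measurable_arrival _).aemeasurable
  map_eq := by
    have hg := hQ.measurable_gap
    have hφ : Measurable (fun x : ℤ → ℝ => ∑ i ∈ Finset.range n, x i) := by fun_prop
    rw [Measure.map_congr (hQ.arrival_zero.mono fun ω h => neg_arrival_neg_natCast_eq_sum_gap h n),
      Measure.map_congr (hQ.arrival_zero.mono fun ω h => arrival_natCast_eq_sum_gap h n)]
    have := congrArg (fun ν => ν.map (fun x : ℤ → ℝ => ∑ i ∈ Finset.range n, x i))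
      (hQ.map_gap_sub n)
    rwa [Measure.map_map hφ (measurable_pi_lambda _ fun i => hg _),
      Measure.map_map hφ (measurable_pi_lambda _ fun i => hg _)] at this

/-- Sum `rate_eq` over the classes: class probabilities and mix both add up to `1`. This identifies
the class probabilities with the mix. -/
theorem inv_integral_gap [IsProbabilityMeasure P]
    (hQ : Q.IsModel P p ρ) : (∫ ω, Q.gap 0 ω ∂P)⁻¹ = ρ * p.lamS := by
  have h1 : ∑ k, P.real (Q.cls 0 ⁻¹' {k}) = 1 := by
    rw [sum_measureReal_preimage_singleton _ fun k _ => hQ.measurable_cls 0 (by trivial)]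
    simp
  have h2 := Finset.sum_congr (rfl : (Finset.univ : Finset TrafficClass) = Finset.univ)
    fun k _ => hQ.rate_eq k
  rw [← Finset.mul_sum, p.mix_sum, mul_one] at h2
  rw [← h2]
  unfold rate
  rw [← Finset.sum_div, div_eq_mul_inv]
  change _ = (∑ k, P.real (Q.cls 0 ⁻¹' {k})) * _
  rw [h1, one_mul]

theorem totalRate_eq (hQ : Q.IsModel P p ρ) : Q.totalRate P = ρ * p.lamS := by
  simp only [totalRate, hQ.rate_eq]
  rw [← Finset.mul_sum, p.mix_sum, mul_one]

theorem measure_cls_eq [IsProbabilityMeasure P]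
    (hQ : Q.IsModel P p ρ) (hρ : 0 < ρ) (k : TrafficClass) :
    P {ω | Q.cls 0 ω = k} = ENNReal.ofReal (p.mix k) := by
  have h := hQ.rate_eq k
  rw [rate, div_eq_mul_inv, hQ.inv_integral_gap, mul_comm] at h
  have hpos := mul_pos hρ p.lamS_pos
  rw [← mul_left_cancel₀ hpos.ne' h, ofReal_measureReal]

/-- Chernoff bound for the arrival time of packet `n`. -/
theorem measure_arrival_le [IsProbabilityMeasure P]
    (hQ : Q.IsModel P p ρ) (hρ : 0 < ρ) (n : ℕ) {b : ℝ} (t : ℝ)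
    (hb : ∫ ω, Real.exp (-(Q.totalRate P * Q.arrival n ω)) ∂P ≤ b) :
    P {ω | Q.arrival n ω ≤ t} ≤ ENNReal.ofReal (Real.exp (ρ * p.lamS * t) * b) := by
  rw [hQ.totalRate_eq] at hb
  have hpos := mul_pos hρ p.lamS_pos
  have hint : Integrable (fun ω => Real.exp (-(ρ * p.lamS) * Q.arrival n ω)) P := by
    refine Integrable.of_bound
      ((hQ.measurable_arrival n).const_mul _).exp.aestronglyMeasurable 1 ?_
    filter_upwards [hQ.boundedPath] with ω h
    have h0 : Q.arrival 0 ω ≤ Q.arrival n ω := h.arrival_mono (by omega)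
    rw [h.arrival_zero] at h0
    rw [Real.norm_eq_abs, Real.abs_exp, Real.exp_le_one_iff]
    nlinarith
  have := measure_le_le_exp_mul_mgf (μ := P) (X := Q.arrival n) t (t := -(ρ * p.lamS))
    (by linarith) hint
  rw [← ofReal_measureReal]
  refine ENNReal.ofReal_le_ofReal (this.trans ?_)
  rw [neg_neg]
  refine mul_le_mul_of_nonneg_left (le_trans (le_of_eq ?_) hb) (Real.exp_nonneg _)
  simp [mgf]

theorem measure_neg_arrival_le (hQ : Q.IsModel P p ρ) (n : ℕ) (t : ℝ) :
    P {ω | -Q.arrival (-n) ω ≤ t} = P {ω | Q.arrival n ω ≤ t} :=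
  (hQ.identDistrib_arrival n).measure_mem_eq (s := Set.Iic t) measurableSet_Iic

/-- Later packets arrive no earlier than packet `1`. This gives the termwise convergence in
`tendsto_tsum_measure_arrival_le`. -/
theorem measure_arrival_succ_le_gap (hQ : Q.IsModel P p ρ) (n : ℕ) (t : ℝ) :
    P {ω | Q.arrival (n + 1) ω ≤ t} ≤ P {ω | Q.gap 0 ω ≤ t} := by
  refine measure_mono_ae ?_
  filter_upwards [hQ.boundedPath] with ω h
  intro h1
  have h2 : Q.arrival 1 ω ≤ Q.arrival ((n : ℤ) + 1) ω := h.arrival_mono (by omega)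
  change Q.arrival (0 + 1) ω - Q.arrival 0 ω ≤ t
  rw [h.arrival_zero, sub_zero, zero_add]
  exact h2.trans h1

/-- Probability that a class-`k` packet is late, bounded by the probability of a backlog at its
release or of an early next arrival. -/
theorem measure_miss_le [IsProbabilityMeasure P]
    (hQ : Q.IsModel P p ρ) (k : TrafficClass)
    (hD : p.latencyBound + p.C k < p.D k) :
    P ({ω | Q.cls 0 ω = k} ∩ {ω | ENNReal.ofReal (p.D k) < Q.response 0 ω}) ≤
      ∑' n : ℕ, P {ω | Q.arrival (n + 1) ω ≤ ((n : ℝ) + 1) * p.serviceBound + p.latencyBound} +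
      P {ω | Q.gap 0 ω ≤ p.latencyBound + p.serviceBound} := by
  have hback : ∑' n : ℕ, P {ω | Q.arrival (n + 1) ω ≤
      ((n : ℝ) + 1) * p.serviceBound + p.latencyBound} = ∑' n : ℕ, P {ω |
        -Q.arrival (-(n + 1)) ω ≤ ((n : ℝ) + 1) * p.serviceBound + p.latencyBound} := by
    refine tsum_congr fun n => ?_
    have := hQ.measure_neg_arrival_le (n + 1)
      (((n : ℝ) + 1) * p.serviceBound + p.latencyBound)
    push_cast at this
    exact this.symm
  rw [hback]
  set A : ℕ → Set Ω := fun n =>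
    {ω | -Q.arrival (-(n + 1)) ω ≤ ((n : ℝ) + 1) * p.serviceBound + p.latencyBound} with hA
  set G : Set Ω := {ω | Q.gap 0 ω ≤ p.latencyBound + p.serviceBound} with hG
  refine le_trans (b := P ((⋃ n, A n) ∪ G)) ?_
    ((measure_union_le _ _).trans (add_le_add_left (measure_iUnion_le _) _))
  refine measure_mono_ae ?_
  filter_upwards [hQ.boundedPath, hQ.service_mem] with ω h hs
  rintro ⟨hk, hlate⟩
  by_contra hgood
  change ω ∉ (⋃ n, A n) ∪ G at hgood
  simp only [hA, hG, Set.mem_union, Set.mem_iUnion, Set.mem_ofPred_eq, not_or, not_exists, not_le]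
    at hgood
  have hw := h.wait_eq_zero p.serviceBound_pos (fun n => (hgood.1 n).le) (by
    have := hgood.2
    rwa [gap, h.arrival_zero, sub_zero, zero_add] at this)
  change Q.cls 0 ω = k at hk
  change _ < Q.response 0 ω at hlate
  rw [response, hw, add_zero, ← ENNReal.ofReal_add (h.activation_nonneg 0) (h.service_nonneg 0)]
    at hlate
  have h1 := (ENNReal.ofReal_lt_ofReal_iff'.1 hlate).1
  -- The slack involves the bound `C k` of the packet's own class, not the common `serviceBound`.
  have h2 := (hs 0).2
  rw [hk] at h2
  linarith [h.activation_le 0]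

/-- Conditioning on the class costs a factor `1 / mix k`, which does not depend on `ρ`. -/
theorem missProb_le [IsProbabilityMeasure P]
    (hQ : Q.IsModel P p ρ) (hρ : 0 < ρ) (k : TrafficClass)
    (hD : p.latencyBound + p.C k < p.D k) :
    ENNReal.ofReal (Q.missProb P p k) ≤ (ENNReal.ofReal (p.mix k))⁻¹ *
      (∑' n : ℕ, P {ω | Q.arrival (n + 1) ω ≤
          ((n : ℝ) + 1) * p.serviceBound + p.latencyBound} +
        P {ω | Q.gap 0 ω ≤ p.latencyBound + p.serviceBound}) := by
  rw [missProb]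
  refine (ENNReal.ofReal_toReal_le).trans ?_
  rw [cond_apply (hQ.measurableSet_cls k),
    hQ.measure_cls_eq hρ]
  exact mul_le_mul_right (hQ.measure_miss_le k hD) _

theorem missProb_nonneg (Q : Queue Ω) (k : TrafficClass) : 0 ≤ Q.missProb P p k :=
  measureReal_nonneg

/-- Conditioning on a null event yields the zero measure. -/
theorem missProb_eq_zero [IsProbabilityMeasure P]
    (hQ : Q.IsModel P p ρ) (hρ : 0 < ρ) {k : TrafficClass}
    (hk : p.mix k = 0) : Q.missProb P p k = 0 := by
  have h := hQ.measure_cls_eq hρ k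
  rw [hk, ENNReal.ofReal_zero] at h
  rw [missProb, cond_eq_zero_of_meas_eq_zero h]
  simp

/-- Bound of the mean queueing delay of an arbitrary packet. -/
theorem lintegral_wait_le [IsProbabilityMeasure P]
    (hQ : Q.IsModel P p ρ) :
    ∫⁻ ω, Q.wait 0 ω ∂P ≤ ENNReal.ofReal (2 * p.serviceBound + p.latencyBound) +
      3 * ∑' n : ℕ, ENNReal.ofReal (((n : ℝ) + 1) * (2 * p.serviceBound) + p.latencyBound) *
        P {ω | Q.arrival (n + 1) ω ≤
          ((n : ℝ) + 1) * (2 * p.serviceBound) + p.latencyBound} := by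
  have hma := hQ.measurable_arrival
  have hfut : ∀ n : ℕ, ∫⁻ ω, ENNReal.ofReal (((n : ℝ) + 1) * (2 * p.serviceBound) +
      p.latencyBound - Q.arrival (n + 1) ω) ∂P ≤
      ENNReal.ofReal (((n : ℝ) + 1) * (2 * p.serviceBound) + p.latencyBound) *
        P {ω | Q.arrival (n + 1) ω ≤
          ((n : ℝ) + 1) * (2 * p.serviceBound) + p.latencyBound} := by
    intro n
    refine lintegral_ofReal_sub_le (hma _) ?_ _
    filter_upwards [hQ.boundedPath] with ω h
    rw [← h.arrival_zero]
    exact h.arrival_mono (by omega)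
  have hpast : ∀ n : ℕ, ∫⁻ ω, ENNReal.ofReal (((n : ℝ) + 1) * (2 * p.serviceBound) +
      p.latencyBound + Q.arrival (-(n + 1)) ω) ∂P = ∫⁻ ω, ENNReal.ofReal (((n : ℝ) + 1) *
        (2 * p.serviceBound) + p.latencyBound - Q.arrival (n + 1) ω) ∂P := by
    intro n
    have h := ((hQ.identDistrib_arrival (n + 1)).comp (u := fun x => ENNReal.ofReal
      (((n : ℝ) + 1) * (2 * p.serviceBound) + p.latencyBound - x)) (by fun_prop)).lintegral_eq
    simpa [Function.comp_def, sub_neg_eq_add, add_comm] using h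
  refine (lintegral_mono_ae (hQ.boundedPath.mono fun ω h =>
    h.wait_le p.serviceBound_pos)).trans ?_
  rw [lintegral_add_right _ (by fun_prop), lintegral_add_left (by fun_prop),
    lintegral_const_mul _ (by fun_prop), lintegral_tsum (fun n => by fun_prop),
    lintegral_tsum (fun n => by fun_prop), lintegral_const, measure_univ, mul_one, add_assoc]
  refine add_le_add_right ?_ _
  simp only [hpast]
  -- Past and future sums have equal expectations; two copies of the first and one of the second
  -- give the factor `3`.
  rw [← add_one_mul, two_add_one_eq_three]
  exact mul_le_mul_right (ENNReal.tsum_le_tsum hfut) _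

theorem meanWait_le [IsProbabilityMeasure P]
    (hQ : Q.IsModel P p ρ) (hρ : 0 < ρ) (k : TrafficClass) :
    Q.meanWait P k ≤ (ENNReal.ofReal (p.mix k))⁻¹ * ∫⁻ ω, Q.wait 0 ω ∂P := by
  rw [meanWait, ProbabilityTheory.cond, lintegral_smul_measure, hQ.measure_cls_eq hρ, smul_eq_mul]
  exact mul_le_mul_right (setLIntegral_le_lintegral _ _) _

end IsModel
end Queue

/-! ### Age and freshness at a fixed activity factor. -/

namespace Params

variable (p : Params)

/-- The largest age `1 / λ_k + 1 / (μ δ)` over the monitoring classes. -/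
noncomputable def baseAge (ρ : ℝ) : ℝ :=
  p.KM.sup' p.KM_nonempty fun k => 1 / (ρ * p.lamS * p.mix k) + 1 / (p.μ * p.δ)

variable {p} {ρ : ℝ}

theorem le_baseAge {k : TrafficClass} (hk : k ∈ p.KM) (ρ : ℝ) :
    1 / (ρ * p.lamS * p.mix k) + 1 / (p.μ * p.δ) ≤ p.baseAge ρ :=
  Finset.le_sup' (fun k => 1 / (ρ * p.lamS * p.mix k) + 1 / (p.μ * p.δ)) hk

theorem baseAge_pos (hρ : 0 < ρ) : 0 < p.baseAge ρ := by
  obtain ⟨k, hk⟩ := p.KM_nonempty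
  refine lt_of_lt_of_le ?_ (le_baseAge hk ρ)
  have := p.lamS_pos
  have := p.mix_pos k hk
  have := p.μ_pos
  have := p.δ_pos
  positivity

theorem tendsto_baseAge : Tendsto p.baseAge (𝓝[>] 0) atTop := by
  obtain ⟨k, hk⟩ := p.KM_nonempty
  refine tendsto_atTop_mono (le_baseAge hk) (tendsto_atTop_add_const_right _ _ ?_)
  have hc : 0 < (p.lamS * p.mix k)⁻¹ := inv_pos.2 (mul_pos p.lamS_pos (p.mix_pos k hk))
  refine (tendsto_inv_nhdsGT_zero.atTop_mul_const hc).congr fun ρ => ?_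
  rw [one_div, mul_assoc, mul_inv ρ]

theorem F₀_eq (ρ : ℝ) : p.F₀ ρ = min 1 (p.Δtar / p.baseAge ρ) := rfl

theorem F₀_pos (hρ : 0 < ρ) : 0 < p.F₀ ρ :=
  lt_min one_pos (div_pos p.Δtar_pos (baseAge_pos hρ))

theorem F₀_le_one (ρ : ℝ) : p.F₀ ρ ≤ 1 := min_le_left _ _

theorem Γmin_pos : 0 < p.Γmin := (Finset.lt_inf'_iff _).2 fun k _ => p.Γ_pos k

end Params

namespace Queue

variable {Ω : Type*} [MeasurableSpace Ω] {P : Measure Ω} {Q : Queue Ω} {p : Params} {ρ : ℝ}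

theorem IsModel.inv_rate_add (hQ : Q.IsModel P p ρ) (hρ : 0 < ρ) {k : TrafficClass}
    (hk : k ∈ p.KM) (w : ℝ≥0∞) :
    (ENNReal.ofReal (Q.rate P k))⁻¹ + w + (ENNReal.ofReal (p.μ * p.δ))⁻¹ =
      ENNReal.ofReal (1 / (ρ * p.lamS * p.mix k) + 1 / (p.μ * p.δ)) + w := by
  have h1 : 0 < ρ * p.lamS * p.mix k := mul_pos (mul_pos hρ p.lamS_pos) (p.mix_pos k hk)
  have h2 : 0 < p.μ * p.δ := mul_pos p.μ_pos p.δ_pos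
  rw [hQ.rate_eq, ENNReal.ofReal_add (by positivity) (by positivity), one_div, one_div,
    ENNReal.ofReal_inv_of_pos h1, ENNReal.ofReal_inv_of_pos h2, add_right_comm]

theorem IsModel.baseAge_le_meanAoS (hQ : Q.IsModel P p ρ) (hρ : 0 < ρ) :
    ENNReal.ofReal (p.baseAge ρ) ≤ Q.meanAoS P p := by
  obtain ⟨k, hk, h⟩ := Finset.exists_mem_eq_sup' p.KM_nonempty
    fun k => 1 / (ρ * p.lamS * p.mix k) + 1 / (p.μ * p.δ)
  rw [Params.baseAge, h]
  refine le_trans ?_ (Finset.le_sup' _ hk)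
  simp only [hQ.inv_rate_add hρ hk]
  exact le_self_add

theorem IsModel.meanAoS_le (hQ : Q.IsModel P p ρ) (hρ : 0 < ρ) {w : ℝ} (hw : 0 ≤ w)
    (h : ∀ k ∈ p.KM, Q.meanWait P k ≤ ENNReal.ofReal w) :
    Q.meanAoS P p ≤ ENNReal.ofReal (p.baseAge ρ + w) := by
  refine Finset.sup'_le _ _ fun k hk => ?_
  rw [hQ.inv_rate_add hρ hk, ENNReal.ofReal_add (Params.baseAge_pos hρ).le hw]
  exact add_le_add (ENNReal.ofReal_le_ofReal (Params.le_baseAge hk ρ))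
    (ENNReal.half_le_self.trans (h k hk))

theorem toReal_min_one_ofReal_div {a b : ℝ} (ha : 0 ≤ a) (hb : 0 < b) :
    (min 1 (ENNReal.ofReal a / ENNReal.ofReal b)).toReal = min 1 (a / b) := by
  rw [← ENNReal.ofReal_div_of_pos hb, ← ENNReal.ofReal_one, ← ENNReal.ofReal_min,
    ENNReal.toReal_ofReal (le_min zero_le_one (div_nonneg ha hb.le))]

theorem IsModel.freshness_le (hQ : Q.IsModel P p ρ) (hρ : 0 < ρ) :
    Q.freshness P p ≤ p.F₀ ρ := by
  rw [Params.F₀_eq, ← toReal_min_one_ofReal_div p.Δtar_pos.le (Params.baseAge_pos hρ), freshness]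
  refine ENNReal.toReal_mono (by simp) (min_le_min_left _ ?_)
  exact ENNReal.div_le_div_left (hQ.baseAge_le_meanAoS hρ) _

/-- Raising the age from `b` to at most `b + w` lowers `min 1 (Δtar / b)` at most by the factor `b /
(b + w)`, which tends to `1` as `b → ∞`. -/
theorem IsModel.le_freshness (hQ : Q.IsModel P p ρ) (hρ : 0 < ρ) {w : ℝ} (hw : 0 ≤ w)
    (h : ∀ k ∈ p.KM, Q.meanWait P k ≤ ENNReal.ofReal w) :
    p.baseAge ρ / (p.baseAge ρ + w) * p.F₀ ρ ≤ Q.freshness P p := by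
  have hb := Params.baseAge_pos (p := p) hρ
  calc p.baseAge ρ / (p.baseAge ρ + w) * p.F₀ ρ ≤ min 1 (p.Δtar / (p.baseAge ρ + w)) := by
        refine le_min ?_ ?_
        · exact mul_le_one₀ (div_le_one_of_le₀ (by linarith) (by linarith))
            (Params.F₀_pos hρ).le (Params.F₀_le_one ρ)
        · calc _ ≤ p.baseAge ρ / (p.baseAge ρ + w) * (p.Δtar / p.baseAge ρ) :=
                mul_le_mul_of_nonneg_left (min_le_right _ _) (by positivity)
            _ = _ := by field_simp
    _ = (min 1 (ENNReal.ofReal p.Δtar / ENNReal.ofReal (p.baseAge ρ + w))).toReal :=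
        (toReal_min_one_ofReal_div p.Δtar_pos.le (by linarith)).symm
    _ ≤ _ := by
        refine ENNReal.toReal_mono (by simp) (min_le_min_left _ ?_)
        exact ENNReal.div_le_div_left (hQ.meanAoS_le hρ hw h) _

end Queue

/-! ### The sparse limit. -/

section Family

variable {Ω : Type*} [MeasurableSpace Ω] {P : Measure Ω} [IsProbabilityMeasure P]
  {p : Params} {ρmax : ℝ} {Q : ℝ → Queue Ω}

theorem eventually_mem_Ioc (hρmax : 0 < ρmax) : ∀ᶠ ρ in 𝓝[>] (0 : ℝ), ρ ∈ Set.Ioc 0 ρmax :=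
  Ioc_mem_nhdsGT hρmax

/-- Geometric decay of the probability of `n` arrivals within a time linear in `n`, uniformly in
the activity factor. -/
theorem exists_geometric_bound (hρmax : 0 < ρmax)
    (hQ : ∀ ρ ∈ Set.Ioc 0 ρmax, (Q ρ).IsModel P p ρ)
    (hburst : ∃ K q : ℝ, q < 1 ∧ ∀ ρ ∈ Set.Ioc 0 ρmax, ∀ n : ℕ,
      ∫ ω, Real.exp (-((Q ρ).totalRate P * (Q ρ).arrival n ω)) ∂P ≤ K * q ^ n)
    (c : ℝ) {v : ℝ} (hv : 0 ≤ v) :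
    ∃ K r : ℝ, 0 ≤ r ∧ r < 1 ∧ ∀ᶠ ρ in 𝓝[>] (0 : ℝ), ∀ n : ℕ,
      P {ω | (Q ρ).arrival (n + 1) ω ≤ ((n : ℝ) + 1) * c + v} ≤
        ENNReal.ofReal (K * r ^ (n + 1)) := by
  obtain ⟨K, q, hq1, hb⟩ := hburst
  have hmax : ρmax ∈ Set.Ioc 0 ρmax := ⟨hρmax, le_rfl⟩
  -- The case `n = 0` of the burst condition; the case `n = 1` then gives `0 ≤ q`.
  have hK : 1 ≤ K := by
    have h0 := hb ρmax hmax 0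
    rw [integral_congr_ae (g := fun _ => 1)] at h0
    · simpa using h0
    · filter_upwards [(hQ ρmax hmax).arrival_zero] with ω h
      simp [h]
  have hq : 0 ≤ q := by
    have h1 := (integral_nonneg fun ω => (Real.exp_nonneg _)).trans (hb ρmax hmax 1)
    rw [pow_one] at h1
    exact nonneg_of_mul_nonneg_right h1 (by linarith)
  have hlim : Tendsto (fun ρ : ℝ => Real.exp (ρ * p.lamS * c) * q) (𝓝[>] 0) (𝓝 q) := by
    have : Continuous fun ρ : ℝ => Real.exp (ρ * p.lamS * c) * q := by fun_prop
    simpa using (this.tendsto 0).mono_left nhdsWithin_le_nhds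
  -- The ratio `exp (ρ * lamS * c) * q` tends to `q`, hence falls below the midpoint of `q` and `1`.
  -- Restricting to `ρ ≤ 1` removes `ρ` from the prefactor.
  refine ⟨Real.exp (p.lamS * v) * K, (q + 1) / 2, by positivity, by linarith, ?_⟩
  filter_upwards [eventually_mem_Ioc hρmax, eventually_mem_Ioc one_pos,
    hlim.eventually_lt_const (show q < (q + 1) / 2 by linarith)] with ρ hρ hρ1 hlt n
  have h1 := (hQ ρ hρ).measure_arrival_le hρ.1 (n + 1) (((n : ℝ) + 1) * c + v) (hb ρ hρ (n + 1))
  push_cast at h1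
  refine h1.trans (ENNReal.ofReal_le_ofReal ?_)
  have hl := p.lamS_pos
  have hexp : Real.exp (ρ * p.lamS * (((n : ℝ) + 1) * c + v)) =
      Real.exp (ρ * p.lamS * c) ^ (n + 1) * Real.exp (ρ * p.lamS * v) := by
    rw [← Real.exp_nat_mul, ← Real.exp_add]
    congr 1
    push_cast
    ring
  calc _ = Real.exp (ρ * p.lamS * v) * K * (Real.exp (ρ * p.lamS * c) * q) ^ (n + 1) := by
        rw [hexp, mul_pow]
        ring
    _ ≤ Real.exp (p.lamS * v) * K * ((q + 1) / 2) ^ (n + 1) := by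
        gcongr
        exact mul_le_of_le_one_left hl.le hρ1.2

theorem tsum_ofReal_linear_mul_geometric_ne_top {a b K r : ℝ} (ha : 0 ≤ a) (hb : 0 ≤ b)
    (hr : 0 ≤ r) (hr1 : r < 1) :
    ∑' n : ℕ, ENNReal.ofReal (((n : ℝ) + 1) * a + b) * ENNReal.ofReal (K * r ^ (n + 1)) ≠ ∞ := by
  have h1 : Summable fun n : ℕ => (n : ℝ) ^ 1 * r ^ n :=
    summable_pow_mul_geometric_of_norm_lt_one 1 (by rwa [Real.norm_of_nonneg hr])
  have h2 : Summable fun n : ℕ => r ^ n := summable_geometric_of_lt_one hr hr1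
  have h3 : Summable fun n : ℕ => (((n : ℝ) + 1) * a + b) * (K * r ^ (n + 1)) := by
    refine ((h1.mul_left (a * K * r)).add (h2.mul_left ((a + b) * K * r))).congr fun n => ?_
    ring
  have h4 : ∀ n : ℕ, ENNReal.ofReal (((n : ℝ) + 1) * a + b) * ENNReal.ofReal (K * r ^ (n + 1)) =
      ENNReal.ofReal ((((n : ℝ) + 1) * a + b) * (K * r ^ (n + 1))) :=
    fun n => (ENNReal.ofReal_mul (by positivity)).symm
  simp only [h4]
  exact h3.tsum_ofReal_ne_top

theorem tendsto_tsum_measure_arrival_le (hρmax : 0 < ρmax)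
    (hQ : ∀ ρ ∈ Set.Ioc 0 ρmax, (Q ρ).IsModel P p ρ)
    (hsep : ∀ h : ℝ, Tendsto (fun ρ => P {ω | (Q ρ).gap 0 ω ≤ h}) (𝓝[>] 0) (𝓝 0))
    (hburst : ∃ K q : ℝ, q < 1 ∧ ∀ ρ ∈ Set.Ioc 0 ρmax, ∀ n : ℕ,
      ∫ ω, Real.exp (-((Q ρ).totalRate P * (Q ρ).arrival n ω)) ∂P ≤ K * q ^ n)
    (c : ℝ) {v : ℝ} (hv : 0 ≤ v) :
    Tendsto (fun ρ => ∑' n : ℕ, P {ω | (Q ρ).arrival (n + 1) ω ≤ ((n : ℝ) + 1) * c + v})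
      (𝓝[>] 0) (𝓝 0) := by
  obtain ⟨K, r, hr, hr1, hbound⟩ := exists_geometric_bound hρmax hQ hburst c hv
  -- The series is an integral over the counting measure, dominated by the geometric bound.
  have := tendsto_lintegral_filter_of_dominated_convergence (μ := Measure.count)
    (F := fun ρ (n : ℕ) => P {ω | (Q ρ).arrival (n + 1) ω ≤ ((n : ℝ) + 1) * c + v})
    (f := fun _ => 0) (l := 𝓝[>] (0 : ℝ)) (fun n : ℕ => ENNReal.ofReal (K * r ^ (n + 1)))
    (Eventually.of_forall fun ρ => measurable_of_countable _)
    (hbound.mono fun ρ h => Eventually.of_forall h) ?_ (Eventually.of_forall fun n => ?_)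
  · simpa only [lintegral_count, tsum_zero] using this
  · rw [lintegral_count]
    -- The linear weight with `a = 0`, `b = 1` is constant.
    simpa using tsum_ofReal_linear_mul_geometric_ne_top le_rfl zero_le_one hr hr1
  · refine tendsto_of_tendsto_of_tendsto_of_le_of_le' tendsto_const_nhds
      (hsep (((n : ℝ) + 1) * c + v)) (Eventually.of_forall fun _ => zero_le) ?_
    filter_upwards [eventually_mem_Ioc hρmax] with ρ hρ
    exact (hQ ρ hρ).measure_arrival_succ_le_gap n _

theorem tendsto_missProb (hρmax : 0 < ρmax)
    (hQ : ∀ ρ ∈ Set.Ioc 0 ρmax, (Q ρ).IsModel P p ρ)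
    (hsep : ∀ h : ℝ, Tendsto (fun ρ => P {ω | (Q ρ).gap 0 ω ≤ h}) (𝓝[>] 0) (𝓝 0))
    (hburst : ∃ K q : ℝ, q < 1 ∧ ∀ ρ ∈ Set.Ioc 0 ρmax, ∀ n : ℕ,
      ∫ ω, Real.exp (-((Q ρ).totalRate P * (Q ρ).arrival n ω)) ∂P ≤ K * q ^ n)
    {k : TrafficClass} (hslack : p.Vmax * (1 - p.δ) + p.C k < p.D k) :
    Tendsto (fun ρ => (Q ρ).missProb P p k) (𝓝[>] 0) (𝓝 0) := by
  -- Without traffic the factor `(mix k)⁻¹` is infinite and the general bound says nothing.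
  rcases (p.mix_nonneg k).eq_or_lt with hk | hk
  · refine (tendsto_congr' ?_).2 tendsto_const_nhds
    filter_upwards [eventually_mem_Ioc hρmax] with ρ hρ
    exact (hQ ρ hρ).missProb_eq_zero hρ.1 hk.symm
  · have hne : (ENNReal.ofReal (p.mix k))⁻¹ ≠ ∞ := by simpa using hk
    have h1 := ENNReal.Tendsto.const_mul (a := (ENNReal.ofReal (p.mix k))⁻¹)
      ((tendsto_tsum_measure_arrival_le hρmax hQ hsep hburst p.serviceBound
        p.latencyBound_nonneg).add (hsep (p.latencyBound + p.serviceBound))) (Or.inr hne)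
    rw [add_zero, mul_zero] at h1
    have h2 : Tendsto (fun ρ => ENNReal.ofReal ((Q ρ).missProb P p k)) (𝓝[>] 0) (𝓝 0) := by
      refine tendsto_of_tendsto_of_tendsto_of_le_of_le' tendsto_const_nhds h1
        (Eventually.of_forall fun _ => zero_le) ?_
      filter_upwards [eventually_mem_Ioc hρmax] with ρ hρ
      exact (hQ ρ hρ).missProb_le hρ.1 k hslack
    have h3 := (ENNReal.tendsto_toReal ENNReal.zero_ne_top).comp h2
    refine h3.congr fun ρ => ?_
    exact ENNReal.toReal_ofReal (Queue.IsModel.missProb_nonneg (Q ρ) k)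

theorem tendsto_reliability (hρmax : 0 < ρmax)
    (hQ : ∀ ρ ∈ Set.Ioc 0 ρmax, (Q ρ).IsModel P p ρ)
    (hsep : ∀ h : ℝ, Tendsto (fun ρ => P {ω | (Q ρ).gap 0 ω ≤ h}) (𝓝[>] 0) (𝓝 0))
    (hburst : ∃ K q : ℝ, q < 1 ∧ ∀ ρ ∈ Set.Ioc 0 ρmax, ∀ n : ℕ,
      ∫ ω, Real.exp (-((Q ρ).totalRate P * (Q ρ).arrival n ω)) ∂P ≤ K * q ^ n)
    (hslack : ∀ k, p.Vmax * (1 - p.δ) + p.C k < p.D k) :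
    Tendsto (fun ρ => (Q ρ).reliability P p) (𝓝[>] 0) (𝓝 p.Γmin) := by
  refine Tendsto.finset_inf'_nhds_apply _ fun k _ => ?_
  have := ((tendsto_missProb hρmax hQ hsep hburst (hslack k)).const_sub 1).mul_const (p.Γ k)
  simpa [Queue.SPDP] using this

/-- The mean queueing delay of a class with traffic is bounded in the sparse limit. -/
theorem exists_meanWait_le (hρmax : 0 < ρmax)
    (hQ : ∀ ρ ∈ Set.Ioc 0 ρmax, (Q ρ).IsModel P p ρ)
    (hburst : ∃ K q : ℝ, q < 1 ∧ ∀ ρ ∈ Set.Ioc 0 ρmax, ∀ n : ℕ,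
      ∫ ω, Real.exp (-((Q ρ).totalRate P * (Q ρ).arrival n ω)) ∂P ≤ K * q ^ n) :
    ∃ w : ℝ, 0 ≤ w ∧ ∀ᶠ ρ in 𝓝[>] (0 : ℝ), ∀ k ∈ p.KM,
      (Q ρ).meanWait P k ≤ ENNReal.ofReal w := by
  obtain ⟨K, r, hr, hr1, hbound⟩ :=
    exists_geometric_bound hρmax hQ hburst (2 * p.serviceBound) p.latencyBound_nonneg
  have hfin := tsum_ofReal_linear_mul_geometric_ne_top (K := K)
    (mul_nonneg zero_le_two p.serviceBound_pos.le) p.latencyBound_nonneg hr hr1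
  set T := ∑' n : ℕ, ENNReal.ofReal (((n : ℝ) + 1) * (2 * p.serviceBound) + p.latencyBound) *
    ENNReal.ofReal (K * r ^ (n + 1))
  set m : TrafficClass → ℝ≥0∞ := fun k => (ENNReal.ofReal (p.mix k))⁻¹ *
    (ENNReal.ofReal (2 * p.serviceBound + p.latencyBound) + 3 * T) with hm
  have hmfin : ∑ k ∈ p.KM, m k ≠ ∞ := by
    refine ENNReal.sum_ne_top.2 fun k hk => ENNReal.mul_ne_top ?_ ?_
    · simpa using p.mix_pos k hk
    · exact ENNReal.add_ne_top.2 ⟨ENNReal.ofReal_ne_top, ENNReal.mul_ne_top (by simp) hfin⟩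
  refine ⟨(∑ k ∈ p.KM, m k).toReal, ENNReal.toReal_nonneg, ?_⟩
  filter_upwards [eventually_mem_Ioc hρmax, hbound] with ρ hρ hb k hk
  rw [ENNReal.ofReal_toReal hmfin]
  refine le_trans ?_ (Finset.single_le_sum (fun _ _ => zero_le) hk)
  refine ((hQ ρ hρ).meanWait_le hρ.1 k).trans (mul_le_mul_right ?_ _)
  refine (hQ ρ hρ).lintegral_wait_le.trans (add_le_add_right (mul_le_mul_right ?_ _) _)
  exact ENNReal.tsum_le_tsum fun n => mul_le_mul_right (hb n) _

theorem tendsto_freshness_div (hρmax : 0 < ρmax)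
    (hQ : ∀ ρ ∈ Set.Ioc 0 ρmax, (Q ρ).IsModel P p ρ)
    (hburst : ∃ K q : ℝ, q < 1 ∧ ∀ ρ ∈ Set.Ioc 0 ρmax, ∀ n : ℕ,
      ∫ ω, Real.exp (-((Q ρ).totalRate P * (Q ρ).arrival n ω)) ∂P ≤ K * q ^ n) :
    Tendsto (fun ρ => (Q ρ).freshness P p / p.F₀ ρ) (𝓝[>] 0) (𝓝 1) := by
  obtain ⟨w, hw, hb⟩ := exists_meanWait_le hρmax hQ hburst
  have hlim : Tendsto (fun ρ => 1 - w / (p.baseAge ρ + w)) (𝓝[>] 0) (𝓝 1) := by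
    have := (tendsto_atTop_add_const_right _ w p.tendsto_baseAge).const_div_atTop w
    simpa using this.const_sub 1
  refine tendsto_of_tendsto_of_tendsto_of_le_of_le' hlim tendsto_const_nhds ?_ ?_
  · filter_upwards [eventually_mem_Ioc hρmax, hb] with ρ hρ h
    have hpos := Params.baseAge_pos (p := p) hρ.1
    rw [le_div_iff₀ (Params.F₀_pos hρ.1)]
    refine le_trans (le_of_eq ?_) ((hQ ρ hρ).le_freshness hρ.1 hw h)
    congr 1
    field_simp
    ring
  · filter_upwards [eventually_mem_Ioc hρmax] with ρ hρ
    exact div_le_one_of_le₀ ((hQ ρ hρ).freshness_le hρ.1) (Params.F₀_pos hρ.1).le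

end Family

end USAM

/-! ### Asymptotics of the product. -/

theorem theorem1 {Ω : Type*} [MeasurableSpace Ω] (P : Measure Ω) [IsProbabilityMeasure P]
    (p : USAM.Params) (ρmax : ℝ) (hρmax : 0 < ρmax) (Q : ℝ → USAM.Queue Ω)
    (hQ : ∀ ρ ∈ Set.Ioc 0 ρmax, (Q ρ).IsModel P p ρ)
    -- consecutive packets are separated by more than any fixed time in the sparse limit
    (hsep : ∀ h : ℝ, Tendsto (fun ρ => P {ω | (Q ρ).gap 0 ω ≤ h}) (𝓝[>] 0) (𝓝 0))
    -- no long dense bursts, on the time scale of the mean interarrival time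
    (hburst : ∃ K q : ℝ, q < 1 ∧ ∀ ρ ∈ Set.Ioc 0 ρmax, ∀ n : ℕ,
      ∫ ω, Real.exp (-((Q ρ).totalRate P * (Q ρ).arrival n ω)) ∂P ≤ K * q ^ n)
    (hutil : Tendsto (fun ρ => (Q ρ).utilization P p) (𝓝[>] 0) (𝓝 0))
    (hslack : ∀ k, p.Vmax * (1 - p.δ) + p.C k < p.D k) :
    (USAM.usam P p Q ~[𝓝[>] 0] fun ρ =>
      p.F₀ ρ ^ p.w₁ * p.Γmin ^ p.w₂ * Real.exp (-(p.w₃ * (p.Bmax / p.SFRT)))) ∧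
    Tendsto (fun ρ => USAM.usam P p Q ρ -
      p.F₀ ρ ^ p.w₁ * p.Γmin ^ p.w₂ * Real.exp (-(p.w₃ * (p.Bmax / p.SFRT))))
      (𝓝[>] 0) (𝓝 0) ∧
    ((fun ρ => (Q ρ).freshness P p) ~[𝓝[>] 0] p.F₀) ∧
    Tendsto (fun ρ => (Q ρ).reliability P p) (𝓝[>] 0) (𝓝 p.Γmin) ∧
    ∀ ρ ρ' : ℝ, USAM.safety p ρ = USAM.safety p ρ' := by
  have hF := USAM.tendsto_freshness_div hρmax hQ hburst
  have hR := USAM.tendsto_reliability hρmax hQ hsep hburst hslack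
  have hΓ := p.Γmin_pos
  set g : ℝ → ℝ := fun ρ =>
    p.F₀ ρ ^ p.w₁ * p.Γmin ^ p.w₂ * Real.exp (-(p.w₃ * (p.Bmax / p.SFRT))) with hg
  have heq : USAM.usam P p Q ~[𝓝[>] 0] g := by
    refine isEquivalent_of_tendsto_one ?_
    -- The quotient factors into powers of `F / F₀` and `R / Γmin`, both tending to `1`; the safety
    -- factor cancels exactly.
    have h1 := hF.rpow_const (p := p.w₁) (Or.inl one_ne_zero)
    have h2 := (hR.div_const p.Γmin).rpow_const (p := p.w₂)
      (Or.inl (div_self hΓ.ne' ▸ one_ne_zero))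
    have h3 := h1.mul h2
    rw [div_self hΓ.ne', Real.one_rpow, Real.one_rpow, one_mul] at h3
    refine h3.congr' ?_
    filter_upwards [USAM.eventually_mem_Ioc hρmax, hR.eventually_const_lt hΓ] with ρ hρ hRpos
    have hF0 := p.F₀_pos hρ.1
    rw [Real.div_rpow (show 0 ≤ (Q ρ).freshness P p from ENNReal.toReal_nonneg) hF0.le,
      Real.div_rpow hRpos.le hΓ.le, Pi.div_apply,
      USAM.usam, USAM.safety, ← Real.exp_mul, hg]
    have e1 := (Real.rpow_pos_of_pos hF0 p.w₁).ne'
    have e2 := (Real.rpow_pos_of_pos hΓ p.w₂).ne'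
    have e3 : -(p.Bmax / p.SFRT) * p.w₃ = -(p.w₃ * (p.Bmax / p.SFRT)) := by ring
    rw [e3]
    have e4 := (Real.exp_pos (-(p.w₃ * (p.Bmax / p.SFRT)))).ne'
    generalize Real.exp (-(p.w₃ * (p.Bmax / p.SFRT))) = E at *
    field_simp
  refine ⟨heq, ?_, isEquivalent_of_tendsto_one hF, hR, fun _ _ => rfl⟩
  -- The difference is `o(g)`, and `g` is bounded because `F₀ ≤ 1` and `w₁ ≥ 0`.
  have hO : g =O[𝓝[>] 0] fun _ => (1 : ℝ) := by
    refine IsBigO.of_bound (p.Γmin ^ p.w₂ * Real.exp (-(p.w₃ * (p.Bmax / p.SFRT)))) ?_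
    filter_upwards [USAM.eventually_mem_Ioc hρmax] with ρ hρ
    have hF0 := p.F₀_pos hρ.1
    rw [Real.norm_of_nonneg (by positivity), norm_one, mul_one, hg]
    simp only [mul_assoc]
    exact mul_le_of_le_one_left (by positivity)
      (Real.rpow_le_one hF0.le (p.F₀_le_one ρ) p.w₁_nonneg)
  exact (isLittleO_one_iff ℝ).1 (heq.isLittleO.trans_isBigO hO)
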